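/- Let $\Omega\subset\mathbb{R}^2$ be a bounded open set with $\Omega=\operatorname{int}\overline{\Omega}$ (for example a bounded Lipschitz domain). A mesh $\mathcal{T}_h$ of $\Omega$ is a finite conforming family of nondegenerate triangles $K$ whose union is $\overline{\Omega}$, and $h$ is the largest diameter of its triangles. On a triangle $K$ with vertices $x_1,x_2,x_3$ let $\varphi_1,\varphi_2,\varphi_3$ be the affine functions with $\varphi_j(x_i)=\delta_{ij}$. There is a constant $C$, depending only on $\Omega$, such that the following holds. Let $A$ (complex-valued) and $\phi$ (real-valued) be $C^2$ functions on a neighbourhood of $\overline{\Omega}$, independent of $\omega$, and let $c>0$ be a wave speed with $|\nabla\phi|=1/c$ on $\overline{\Omega}$. Let $(u_\omega)$ be a family of wave fields, in $L^2(\Omega)$ for all large $\omega$, with $$u_\omega = A e^{i\omega\phi}+O(\omega^{-1})\quad\text{in } L^2(\Omega),\ \omega\to\infty .$$ For a mesh $\mathcal{T}_h$ of $\Omega$ let, with $k_j=\omega/c(x_j)$ and the exact ray directions $\widehat{d}_j=\nabla\phi(x_j)/|\nabla\phi(x_j)|$, $$V_{Ray}(K)=\operatorname{span}_{\mathbb{C}}\{\varphi_j(x)e^{ik_j\widehat{d}_j\cdot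 x}: j=1,2,3\},\qquad V_{Ray}(\mathcal{T}_h)=\{v\in C^0(\overline{\Omega}) : v|_K\in V_{Ray}(K)\ \ \forall K\in\mathcal{T}_h\}.$$ 1. There are $R$ and $\omega_0>0$ such that for all $\omega\ge\omega_0$ and all meshes $\mathcal{T}_h$ of $\Omega$ $$\inf_{u_h\in V_{Ray}(\mathcal{T}_h)}\|u_\omega-u_h\|_{L^2(\Omega)}\le C\left(h^2|A|_{H^2(\Omega)}+\omega h^2\|A\|_{L^\infty(\Omega)}\|\nabla^2\phi\|_{L^\infty(\Omega)}\right)+R\,\omega^{-1}.$$ 2. There are $M$ and $\omega_0>0$ such that for all $\omega\ge\omega_0$ and all meshes $\mathcal{T}_h$ of $\Omega$ $$\inf_{u_h\in V_{Ray}(\mathcal{T}_h)}\|u_\omega-u_h\|_{L^2(\Omega)}\le M\,(h^2+\omega h^2+\omega^{-1}).$$ 3. For every $\kappa>0$ there are $M$ and $\omega_0>0$ such that $\inf_{u_h\in V_{Ray}(\mathcal{T}_h)}\|u_\omega-u_h\|_{L^2(\Omega)}\le M\omega^{-1}$ for all $\omega\ge\omega_0$ and all meshes $\mathcal{T}_h$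 of $\Omega$ with $h\le\kappa\,\omega^{-1}$. -/

import Mathlib

open Set Filter Topology MeasureTheory
open scoped NNReal ENNReal

noncomputable section

namespace RayFEM

/-- The Euclidean plane. -/
abbrev Plane : Type := EuclideanSpace ℝ (Fin 2)

/-! ### Triangular meshes -/

/-- The vertex sets of the triangles (two-dimensional faces) of a planar simplicial complex. -/
def triangles (T : Geometry.SimplicialComplex ℝ Plane) : Set (Finset Plane) :=
  {K | K ∈ T.faces ∧ K.card = 3}

/-- The closed triangle with vertex set `K`. -/
def closedTriangle (K : Finset Plane) : Set Plane :=
  convexHull ℝ (K : Set Plane)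

/-- `T` is a conforming triangular mesh of `Ω`: a finite simplicial complex whose triangles
cover exactly the closure of `Ω`.  Nondegeneracy of the triangles and the fact that two of them
meet in a common face (if at all) are part of `Geometry.SimplicialComplex`. -/
structure IsMesh (T : Geometry.SimplicialComplex ℝ Plane) (Ω : Set Plane) : Prop where
  finite_faces : T.faces.Finite
  cover : ⋃ K ∈ triangles T, closedTriangle K = closure Ω

/-- The mesh width `h`: the largest diameter of a triangle of the mesh. -/
def meshWidth (T : Geometry.SimplicialComplex ℝ Plane) : ℝ :=
  sSup ((fun K => Metric.diam (closedTriangle K)) '' triangles T)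

/-! ### The ray-FEM space -/

/-- `ψ` is the P1 nodal basis function of the triangle with vertex set `K` at its vertex `p`:
the affine function which is `1` at `p` and `0` at the other vertices. -/
def IsNodalBasis (K : Finset Plane) (p : Plane) (ψ : Plane →ᵃ[ℝ] ℝ) : Prop :=
  ψ p = 1 ∧ ∀ q ∈ K, q ≠ p → ψ q = 0

/-- The plane wave `x ↦ exp (i κ d · x)` of wave number `κ` and direction `d`. -/
def planeWave (κ : ℝ) (d : Plane) (x : Plane) : ℂ :=
  Complex.exp (Complex.I * ((κ * inner ℝ d x : ℝ) : ℂ))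

/-- The local ray-FEM space on the triangle with vertices `K`: the complex span of the
functions `ψ_p(x) exp (i k(p) d · x)`, where `p` runs through the vertices, `ψ_p` is the nodal
basis function at `p`, and `d` runs through the set `D p` of ray directions at `p`. -/
def localRaySpace (k : Plane → ℝ) (D : Plane → Set Plane) (K : Finset Plane) :
    Submodule ℂ (Plane → ℂ) :=
  Submodule.span ℂ {f | ∃ p ∈ K, ∃ ψ : Plane →ᵃ[ℝ] ℝ, IsNodalBasis K p ψ ∧
    ∃ d ∈ D p, f = fun x => ((ψ x : ℝ) : ℂ) * planeWave (k p) d x}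

/-- The global ray-FEM space: functions continuous on the closure of `Ω` whose restriction to
each triangle of the mesh belongs to the local ray-FEM space of that triangle. -/
def raySpace (Ω : Set Plane) (T : Geometry.SimplicialComplex ℝ Plane)
    (k : Plane → ℝ) (D : Plane → Set Plane) : Submodule ℂ (Plane → ℂ) where
  carrier := {v | ContinuousOn v (closure Ω) ∧
    ∀ K ∈ triangles T, ∃ w ∈ localRaySpace k D K, EqOn v w (closedTriangle K)}
  zero_mem' := ⟨continuousOn_const, fun _ _ => ⟨0, Submodule.zero_mem _, fun _ _ => rfl⟩⟩
  add_mem' := by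
    rintro v v' ⟨hv, hvK⟩ ⟨hv', hvK'⟩
    refine ⟨hv.add hv', fun K hK => ?_⟩
    obtain ⟨w, hw, hvw⟩ := hvK K hK
    obtain ⟨w', hw', hvw'⟩ := hvK' K hK
    refine ⟨w + w', Submodule.add_mem _ hw hw', fun x hx => ?_⟩
    simp [hvw hx, hvw' hx]
  smul_mem' := by
    rintro a v ⟨hv, hvK⟩
    refine ⟨hv.const_smul a, fun K hK => ?_⟩
    obtain ⟨w, hw, hvw⟩ := hvK K hK
    refine ⟨a • w, Submodule.smul_mem _ a hw, fun x hx => ?_⟩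
    simp [hvw hx]

/-- The ray direction `∇φ(x) / |∇φ(x)|` of the phase `φ` at `x`. -/
def rayDirection (φ : Plane → ℝ) (x : Plane) : Plane :=
  ‖gradient φ x‖⁻¹ • gradient φ x

/-- The ray-FEM space with exact ray information for a single wave of phase `φ` and frequency
`ω` in a medium with wave speed `c`: the wave number is `ω / c`, and the only ray direction at a
node is that of `∇φ`. -/
def exactRaySpace (Ω : Set Plane) (T : Geometry.SimplicialComplex ℝ Plane)
    (c φ : Plane → ℝ) (ω : ℝ) : Submodule ℂ (Plane → ℂ) :=
  raySpace Ω T (fun x => ω / c x) (fun x => {rayDirection φ x})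

/-! ### Norms and errors -/

/-- The `L²(Ω)` norm. -/
def normL2 (Ω : Set Plane) (f : Plane → ℂ) : ℝ≥0∞ :=
  eLpNorm f 2 (volume.restrict Ω)

/-- The second partial derivative `∂_i ∂_j f`. -/
def secondPartial (i j : Fin 2) (f : Plane → ℂ) (x : Plane) : ℂ :=
  iteratedFDeriv ℝ 2 f x ![EuclideanSpace.single i 1, EuclideanSpace.single j 1]

/-- The seminorm `|f|_{H²(Ω)}` (for functions twice continuously differentiable around `Ω`):
the square root of the sum of the squares of the `L²(Ω)` norms of all second partials. -/
def seminormH2 (Ω : Set Plane) (f : Plane → ℂ) : ℝ≥0∞ :=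
  (∑ i : Fin 2, ∑ j : Fin 2, normL2 Ω (secondPartial i j f) ^ 2) ^ (1 / 2 : ℝ)

/-- The norm `‖f‖_{L^∞(Ω)}`. -/
def normLinf (Ω : Set Plane) (f : Plane → ℂ) : ℝ≥0∞ :=
  eLpNorm f ⊤ (volume.restrict Ω)

/-- The norm `‖∇²φ‖_{L^∞(Ω)}`, with the norm of `∇²φ(x)` as a bilinear form. -/
def hessianLinf (Ω : Set Plane) (φ : Plane → ℝ) : ℝ≥0∞ :=
  eLpNorm (fun x => iteratedFDeriv ℝ 2 φ x) ⊤ (volume.restrict Ω)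

/-- The best approximation error `inf_{v ∈ V} ‖u - v‖_{L²(Ω)}`. -/
def bestError (Ω : Set Plane) (V : Submodule ℂ (Plane → ℂ)) (u : Plane → ℂ) : ℝ≥0∞ :=
  ⨅ v ∈ V, normL2 Ω (u - v)

/-! ### The geometric optics ansatz -/

/-- The leading-order geometric optics wave `A exp (i ω φ)`. -/
def goWave (A : Plane → ℂ) (φ : Plane → ℝ) (ω : ℝ) (x : Plane) : ℂ :=
  A x * Complex.exp (Complex.I * ((ω * φ x : ℝ) : ℂ))

/-- The single-wave geometric optics ansatz `u_ω = A exp (i ω φ) + O(1/ω)` in `L²(Ω)`, as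
`ω → ∞`, for a family `u` of `L²` wave fields indexed by the frequency. -/
def GeometricOpticsAnsatz (Ω : Set Plane) (A : Plane → ℂ) (φ : Plane → ℝ)
    (u : ℝ → Plane → ℂ) : Prop :=
  (∀ᶠ ω in atTop, MemLp (u ω) 2 (volume.restrict Ω)) ∧
    ∃ M : ℝ, ∀ᶠ ω in atTop, normL2 Ω (u ω - goWave A φ ω) ≤ ENNReal.ofReal (M / ω)

end RayFEM

end

namespace RayFEM

/-! The competitor is the nodal ray interpolant. By the eikonal equation `ω / c p` times the ray
direction at `p` is `ω ∇φ(p)`, so after a constant phase correction the basis wave at `p` is `exp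
(iω(φ(p) + ∇φ(p)·(x - p)))`, the wave of the phase linearized at `p` (`mul_inner_rayDirection`).
Since this wave depends on the node only, multiplying it by a continuous hat function gives a
conforming function.

Because the hat functions sum to 1, the error for `A exp (iωφ)` splits into two pieces. The first is
the P1 interpolation error of `A` times a unimodular factor (`setLIntegral_interpolation_error_le`).
The second is a convex combination of phase errors, each at most `ω h²` times the Hessian bound for
`φ`, since `|e^{is} - e^{it}| ≤ |s - t|`.

No shape regularity of the triangles is needed. The Taylor remainder at `x` towards a vertex `p`
carries the kernel `1 - t`; after squaring, its weight `(1 - t)²` cancels exactly the Jacobian of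
the homothety of centre `p` and ratio `1 - t`, which maps the triangle into itself
(`lintegral_homothety_le`). -/

/-! ### Piecewise affine hat functions -/

/-- On an affinely independent vertex set the nodal functions extend to affine functions. -/
lemma exists_affineMap_eq_ite {K : Finset Plane}
    (hK : AffineIndependent ℝ ((↑) : K → Plane)) (p : Plane) :
    ∃ ψ : Plane →ᵃ[ℝ] ℝ, ∀ q ∈ K, ψ q = if q = p then 1 else 0 := by
  classical
  obtain ⟨t, hKt, ht, htop⟩ := exists_subset_affineIndependent_affineSpan_eq_top
    (k := ℝ) (V := Plane) (P := Plane) (s := (K : Set Plane)) hK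
  let b : AffineBasis t ℝ Plane := ⟨((↑) : t → Plane), ht, by rwa [Subtype.range_coe]⟩
  by_cases hp : p ∈ t
  · refine ⟨b.coord ⟨p, hp⟩, fun q hq => ?_⟩
    have h := b.coord_apply ⟨p, hp⟩ ⟨q, hKt hq⟩
    change b.coord ⟨p, hp⟩ q = _ at h
    rw [h]
    simp [eq_comm]
  · refine ⟨0, fun q hq => ?_⟩
    have : q ≠ p := fun h => hp (h ▸ hKt hq)
    simp [this]

lemma affineMap_apply_sum_smul (ψ : Plane →ᵃ[ℝ] ℝ) (s : Finset Plane) (w : Plane → ℝ)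
    (hw : ∑ q ∈ s, w q = 1) : ψ (∑ q ∈ s, w q • q) = ∑ q ∈ s, w q * ψ q := by
  have h := s.map_affineCombination (id : Plane → Plane) w hw ψ
  rw [Finset.affineCombination_eq_linear_combination _ _ _ hw,
    Finset.affineCombination_eq_linear_combination _ _ _ hw] at h
  simpa using h

variable {T : Geometry.SimplicialComplex ℝ Plane} {Ω : Set Plane}

lemma IsMesh.finite_triangles (hT : IsMesh T Ω) : (triangles T).Finite :=
  hT.finite_faces.subset fun _ hK => hK.1

lemma isClosed_closedTriangle (K : Finset Plane) : IsClosed (closedTriangle K) :=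
  (K.finite_toSet.isCompact_convexHull (𝕜 := ℝ)).isClosed

lemma IsMesh.closedTriangle_subset (hT : IsMesh T Ω) {K : Finset Plane} (hK : K ∈ triangles T) :
    closedTriangle K ⊆ closure Ω :=
  hT.cover ▸ subset_biUnion_of_mem (u := closedTriangle) hK

lemma IsMesh.exists_mem (hT : IsMesh T Ω) {x : Plane} (hx : x ∈ closure Ω) :
    ∃ K ∈ triangles T, x ∈ closedTriangle K := by
  rw [← hT.cover] at hx
  simpa using hx

lemma dist_le_meshWidth (hT : IsMesh T Ω) {K : Finset Plane} (hK : K ∈ triangles T)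
    {x y : Plane} (hx : x ∈ closedTriangle K) (hy : y ∈ closedTriangle K) :
    dist x y ≤ meshWidth T := by
  have hb : Bornology.IsBounded (closedTriangle K) :=
    (K.finite_toSet.isCompact_convexHull (𝕜 := ℝ)).isBounded
  refine (Metric.dist_le_diam_of_mem hb hx hy).trans ?_
  exact le_csSup (hT.finite_triangles.image _).bddAbove (mem_image_of_mem _ hK)

lemma meshWidth_nonneg (T : Geometry.SimplicialComplex ℝ Plane) : 0 ≤ meshWidth T :=
  Real.sSup_nonneg <| by
    rintro _ ⟨K, -, rfl⟩
    exact Metric.diam_nonneg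

/-- The continuous piecewise affine hat functions of a mesh. -/
lemma IsMesh.exists_hat (hT : IsMesh T Ω) : ∃ hat : Plane → Plane → ℝ,
    (∀ p, ContinuousOn (hat p) (closure Ω)) ∧
      ∀ K ∈ triangles T, ∀ p, ∃ ψ : Plane →ᵃ[ℝ] ℝ,
        (∀ q ∈ K, ψ q = if q = p then 1 else 0) ∧ EqOn (hat p) ψ (closedTriangle K) := by
  classical
  choose! ψ hψ using fun (K : Finset Plane) (hK : K ∈ triangles T) =>
    exists_affineMap_eq_ite (T.indep hK.1)
  -- Conformity: a common point is a combination of common vertices, where both affine functions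
  -- take the same values.
  have key : ∀ K ∈ triangles T, ∀ K' ∈ triangles T, ∀ p, ∀ x ∈ closedTriangle K,
      x ∈ closedTriangle K' → ψ K p x = ψ K' p x := by
    intro K hK K' hK' p x hx hx'
    have hmem := T.inter_subset_convexHull hK.1 hK'.1 ⟨hx, hx'⟩
    rw [← Finset.coe_inter, Finset.mem_convexHull'] at hmem
    obtain ⟨w, -, hw1, rfl⟩ := hmem
    rw [affineMap_apply_sum_smul _ _ _ hw1, affineMap_apply_sum_smul _ _ _ hw1]
    refine Finset.sum_congr rfl fun q hq => ?_
    rw [hψ K hK p q (Finset.mem_inter.1 hq).1, hψ K' hK' p q (Finset.mem_inter.1 hq).2]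
  -- By `key` the chosen triangle does not matter; the default 0 only concerns points off the mesh.
  let hat : Plane → Plane → ℝ := fun p x =>
    if h : ∃ K ∈ triangles T, x ∈ closedTriangle K then ψ h.choose p x else 0
  have heq : ∀ K ∈ triangles T, ∀ p, EqOn (hat p) (ψ K p) (closedTriangle K) := by
    intro K hK p x hx
    have h : ∃ K ∈ triangles T, x ∈ closedTriangle K := ⟨K, hK, hx⟩
    simp only [hat, dif_pos h]
    exact key _ h.choose_spec.1 K hK p x h.choose_spec.2 hx
  refine ⟨hat, fun p => ?_, fun K hK p => ⟨ψ K p, hψ K hK p, heq K hK p⟩⟩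
  have := hT.finite_triangles.to_subtype
  rw [← hT.cover, biUnion_eq_iUnion]
  refine (locallyFinite_of_finite _).continuousOn_iUnion
    (fun K => isClosed_closedTriangle K.1) fun K => ?_
  exact ((ψ K p).continuous_of_finiteDimensional.continuousOn).congr (heq K K.2 p)

/-- The values of the hat functions at a point of a triangle are barycentric coordinates. -/
lemma hat_eq_weights {hat : Plane → Plane → ℝ} {K : Finset Plane}
    (h : ∀ p, ∃ ψ : Plane →ᵃ[ℝ] ℝ,
        (∀ q ∈ K, ψ q = if q = p then 1 else 0) ∧ EqOn (hat p) ψ (closedTriangle K))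
    {x : Plane} (hx : x ∈ closedTriangle K) :
    (∀ p ∈ K, 0 ≤ hat p x) ∧ (∀ p ∉ K, hat p x = 0) ∧ ∑ p ∈ K, hat p x = 1 ∧
      ∑ p ∈ K, hat p x • p = x := by
  classical
  obtain ⟨w, hw0, hw1, hwx⟩ := Finset.mem_convexHull'.1 hx
  -- An affine function that is 1 at `p` and 0 at the other vertices reads off the weight of `p`.
  have hval : ∀ p, hat p x = if p ∈ K then w p else 0 := by
    intro p
    obtain ⟨ψ, hψ, he⟩ := h p
    rw [he hx, ← hwx, affineMap_apply_sum_smul _ _ _ hw1]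
    rw [Finset.sum_congr rfl fun q hq => by rw [hψ q hq]]
    simp
  have hK : ∀ p ∈ K, hat p x = w p := fun p hp => by rw [hval, if_pos hp]
  refine ⟨fun p hp => hK p hp ▸ hw0 p hp, fun p hp => by rw [hval, if_neg hp], ?_, ?_⟩
  · rw [Finset.sum_congr rfl hK, hw1]
  · rw [Finset.sum_congr rfl fun p hp => by rw [hK p hp], hwx]

/-! ### Measure of triangles -/

/-- Distinct triangles share at most two vertices, so their intersection lies in a proper affine
subspace. -/
lemma volume_closedTriangle_inter {K K' : Finset Plane}
    (hK : K ∈ triangles T) (hK' : K' ∈ triangles T) (hne : K ≠ K') :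
    volume (closedTriangle K ∩ closedTriangle K') = 0 := by
  classical
  refine measure_mono_null (T.inter_subset_convexHull hK.1 hK'.1) ?_
  rw [← Finset.coe_inter]
  refine measure_mono_null (convexHull_subset_affineSpan _) ?_
  refine Measure.addHaar_affineSubspace volume _ fun htop => ?_
  have hlt : (K ∩ K').card < 3 := by
    rw [← hK.2]
    refine Finset.card_lt_card (Finset.ssubset_iff_subset_ne.2 ⟨Finset.inter_subset_left, ?_⟩)
    intro h
    exact hne (Finset.eq_of_subset_of_card_le (Finset.inter_eq_left.1 h) (by rw [hK.2, hK'.2]))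
  have hdir : vectorSpan ℝ ((K ∩ K' : Finset Plane) : Set Plane) = ⊤ := by
    rw [← direction_affineSpan, htop, AffineSubspace.direction_top]
  have hne' : (K ∩ K').Nonempty := by
    rw [← Finset.coe_nonempty, ← affineSpan_nonempty (k := ℝ), htop]
    exact ⟨0, trivial⟩
  have hfin := finrank_vectorSpan_image_finset_le ℝ (id : Plane → Plane) (K ∩ K')
    (n := (K ∩ K').card - 1) (by have := hne'.card_pos; omega)
  rw [Finset.image_id, hdir, finrank_top, finrank_euclideanSpace, Fintype.card_fin] at hfin
  omega

/-- Integrals over the triangles of a mesh add up to at most the integral over the domain. -/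
lemma sum_setLIntegral_closedTriangle_le (hT : IsMesh T Ω) (hreg : interior (closure Ω) = Ω)
    {s : Finset (Finset Plane)} (hs : ∀ K, K ∈ s ↔ K ∈ triangles T) (G : Plane → ℝ≥0∞) :
    ∑ K ∈ s, ∫⁻ x in closedTriangle K, G x ≤ ∫⁻ x in Ω, G x := by
  -- Closed triangles are only known to lie in `closure Ω`; their interiors, which differ from them
  -- by null sets, lie in `interior (closure Ω) = Ω`.
  have hfr : ∀ K : Finset Plane,
      (closedTriangle K : Set Plane) =ᵐ[volume] interior (closedTriangle K) := fun K =>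
    (interior_ae_eq_of_null_frontier
      ((convex_convexHull ℝ (K : Set Plane)).addHaar_frontier volume)).symm
  rw [Finset.sum_congr rfl fun K _ => setLIntegral_congr (hfr K), ← lintegral_biUnion_finset₀]
  · refine lintegral_mono_set (iUnion₂_subset fun K hK => ?_)
    rw [← hreg]
    exact interior_mono (hT.closedTriangle_subset ((hs K).1 hK))
  · intro K hK K' hK' hne
    exact measure_mono_null (inter_subset_inter interior_subset interior_subset)
      (volume_closedTriangle_inter ((hs K).1 hK) ((hs K').1 hK') hne)
  · exact fun K _ => isOpen_interior.measurableSet.nullMeasurableSet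

lemma setLIntegral_le_sum_closedTriangle (hT : IsMesh T Ω)
    {s : Finset (Finset Plane)} (hs : ∀ K, K ∈ s ↔ K ∈ triangles T) (G : Plane → ℝ≥0∞) :
    ∫⁻ x in Ω, G x ≤ ∑ K ∈ s, ∫⁻ x in closedTriangle K, G x := by
  have hsub : Ω ⊆ ⋃ K : s, closedTriangle K.1 := by
    intro x hx
    obtain ⟨K, hK, hxK⟩ := hT.exists_mem (subset_closure hx)
    exact mem_iUnion.2 ⟨⟨K, (hs K).2 hK⟩, hxK⟩
  refine (lintegral_mono_set hsub).trans ((lintegral_iUnion_le _ _).trans ?_)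
  rw [tsum_fintype, Finset.sum_coe_sort s fun K => ∫⁻ x in closedTriangle K, G x]


/-! ### Taylor's formula -/

section Taylor

variable {F : Type*} [NormedAddCommGroup F] [NormedSpace ℝ F] {f : Plane → F} {U : Set Plane}

lemma continuousOn_iteratedFDeriv_two (hU : IsOpen U) (hf : ContDiffOn ℝ 2 f U) :
    ContinuousOn (iteratedFDeriv ℝ 2 f) U :=
  (hf.continuousOn_iteratedFDerivWithin (m := 2) le_rfl hU.uniqueDiffOn).congr fun _ hx =>
    (iteratedFDerivWithin_of_isOpen 2 hU hx).symm

lemma continuousOn_iteratedFDeriv_two_apply (hU : IsOpen U) (hf : ContDiffOn ℝ 2 f U)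
    (m : Fin 2 → Plane) : ContinuousOn (fun x => iteratedFDeriv ℝ 2 f x m) U :=
  (ContinuousMultilinearMap.apply ℝ (fun _ : Fin 2 => Plane) F m).continuous.comp_continuousOn
    (continuousOn_iteratedFDeriv_two hU hf)

/-- Taylor's formula of order two with integral remainder, along a segment. -/
lemma taylor_segment [CompleteSpace F] (hU : IsOpen U) (hf : ContDiffOn ℝ 2 f U) {x p : Plane}
    (hseg : ∀ t ∈ Icc (0 : ℝ) 1, x + t • (p - x) ∈ U) :
    f p = f x + fderiv ℝ f x (p - x) +
      ∫ t in (0 : ℝ)..1, (1 - t) • iteratedFDeriv ℝ 2 f (x + t • (p - x)) ![p - x, p - x] := by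
  set v := p - x with hv
  have hγ : ∀ t : ℝ, HasDerivAt (fun t : ℝ => x + t • v) v t := fun t => by
    simpa using ((hasDerivAt_id t).smul_const v).const_add x
  -- This function goes from `f x + Df(x)v` at `t = 0` to `f p` at `t = 1`; the first-order terms
  -- cancel in its derivative, leaving the remainder integrand.
  have hd : ∀ t ∈ Icc (0 : ℝ) 1, HasDerivAt
      (fun t : ℝ => f (x + t • v) + (1 - t) • fderiv ℝ f (x + t • v) v)
      ((1 - t) • iteratedFDeriv ℝ 2 f (x + t • v) ![v, v]) t := by
    intro t ht
    have hc : ContDiffAt ℝ 2 f (x + t • v) := hf.contDiffAt (hU.mem_nhds (hseg t ht))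
    have h1 : HasDerivAt (fun t : ℝ => f (x + t • v)) (fderiv ℝ f (x + t • v) v) t :=
      (hc.differentiableAt (by norm_num)).hasFDerivAt.comp_hasDerivAt t (hγ t)
    have hc' : ContDiffAt ℝ 1 (fderiv ℝ f) (x + t • v) :=
      hc.fderiv_right (m := 1) (by norm_num)
    have h2 : HasDerivAt (fun t : ℝ => fderiv ℝ f (x + t • v))
        (fderiv ℝ (fderiv ℝ f) (x + t • v) v) t :=
      (hc'.differentiableAt (by norm_num)).hasFDerivAt.comp_hasDerivAt t (hγ t)
    have h3 := h2.clm_apply (hasDerivAt_const t v)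
    have h4 := h1.add (((hasDerivAt_id t).const_sub 1).smul h3)
    refine h4.congr_deriv ?_
    rw [iteratedFDeriv_two_apply]
    simp
  have hcont : ContinuousOn
      (fun t : ℝ => (1 - t) • iteratedFDeriv ℝ 2 f (x + t • v) ![v, v]) (Icc 0 1) := by
    refine ContinuousOn.smul (by fun_prop) ?_
    exact (continuousOn_iteratedFDeriv_two_apply hU hf ![v, v]).comp (by fun_prop) hseg
  have := intervalIntegral.integral_eq_sub_of_hasDerivAt (a := (0 : ℝ)) (b := 1)
    (fun t ht => hd t (by rwa [uIcc_of_le zero_le_one] at ht))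
    (hcont.intervalIntegrable_of_Icc zero_le_one)
  rw [this]
  simp [hv]

/-- The uniform version, used for the phase. The kernel `1 - t` is bounded by 1, which gives up the
usual factor 1/2. -/
lemma norm_sub_taylor_le [CompleteSpace F] (hU : IsOpen U) (hf : ContDiffOn ℝ 2 f U)
    {x p : Plane} (hseg : ∀ t ∈ Icc (0 : ℝ) 1, x + t • (p - x) ∈ U) {b h : ℝ}
    (hb : ∀ t ∈ Icc (0 : ℝ) 1, ‖iteratedFDeriv ℝ 2 f (x + t • (p - x))‖ ≤ b)
    (hh : ‖p - x‖ ≤ h) :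
    ‖f p - (f x + fderiv ℝ f x (p - x))‖ ≤ b * h ^ 2 := by
  have hb0 : 0 ≤ b := (norm_nonneg _).trans (hb 0 (by simp))
  rw [sub_eq_iff_eq_add'.2 (taylor_segment hU hf hseg)]
  have := intervalIntegral.norm_integral_le_of_norm_le_const (a := (0 : ℝ)) (b := 1)
    (f := fun t => (1 - t) • iteratedFDeriv ℝ 2 f (x + t • (p - x)) ![p - x, p - x])
    (C := b * h ^ 2) ?_
  · simpa using this
  intro t ht
  rw [uIoc_of_le zero_le_one] at ht
  have ht' : t ∈ Icc (0 : ℝ) 1 := ⟨ht.1.le, ht.2⟩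
  rw [norm_smul, Real.norm_of_nonneg (sub_nonneg.2 ht.2)]
  refine (mul_le_of_le_one_left (norm_nonneg _) (by linarith [ht.1])).trans ?_
  refine (ContinuousMultilinearMap.le_opNorm _ _).trans ?_
  rw [Fin.prod_univ_two]
  have h2 : ‖p - x‖ * ‖p - x‖ ≤ h ^ 2 := by
    rw [← sq]
    exact pow_le_pow_left₀ (norm_nonneg _) hh 2
  exact mul_le_mul (hb t ht') h2 (by positivity) hb0

end Taylor

/-! ### The interpolation error in `L²` -/

/-- Expansion in coordinates and Cauchy–Schwarz: the squares of the four products `v i * v j` sum to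
`‖v‖ ^ 4`. This brings in exactly the second partials of the `H²` seminorm. -/
lemma norm_bilin_sq_le (B : ContinuousMultilinearMap ℝ (fun _ : Fin 2 => Plane) ℂ) (v : Plane) :
    ‖B ![v, v]‖ ^ 2 ≤ ‖v‖ ^ 4 * ∑ i : Fin 2, ∑ j : Fin 2,
      ‖B ![EuclideanSpace.single i 1, EuclideanSpace.single j 1]‖ ^ 2 := by
  set e : Fin 2 → Plane := fun i => EuclideanSpace.single i 1 with he
  have hv : v = v 0 • e 0 + v 1 • e 1 := by
    ext i
    fin_cases i <;> simp [he]
  have hleft : ∀ (a b : Plane) (s t : ℝ) (c : Plane),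
      B ![s • a + t • b, c] = s • B ![a, c] + t • B ![b, c] := by
    intro a b s t c
    have h1 := B.cons_add (m := ![c]) (s • a) (t • b)
    have h2 := B.cons_smul (m := ![c]) s a
    have h3 := B.cons_smul (m := ![c]) t b
    exact h1.trans (by rw [h2, h3]; rfl)
  have hright : ∀ (a b : Plane) (s t : ℝ) (c : Plane),
      B ![c, s • a + t • b] = s • B ![c, a] + t • B ![c, b] := by
    intro a b s t c
    have hu : ∀ z : Plane, Function.update ![c, c] 1 z = ![c, z] := fun z => by
      ext i; fin_cases i <;> simp
    have h1 := B.map_update_add ![c, c] 1 (s • a) (t • b)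
    have h2 := B.map_update_smul ![c, c] 1 s a
    have h3 := B.map_update_smul ![c, c] 1 t b
    rw [hu, hu] at h2 h3
    rw [hu, hu, hu, h2, h3] at h1
    exact h1
  have hexp : B ![v, v] = ∑ k : Fin 2 × Fin 2, (v k.1 * v k.2) • B ![e k.1, e k.2] := by
    conv_lhs => rw [hv]
    rw [hleft, hright, hright, Fintype.sum_prod_type]
    simp only [Fin.sum_univ_two, smul_add, smul_smul]
  have hle : ‖B ![v, v]‖ ≤ ∑ k : Fin 2 × Fin 2, |v k.1 * v k.2| * ‖B ![e k.1, e k.2]‖ := by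
    rw [hexp]
    refine (norm_sum_le _ _).trans (le_of_eq ?_)
    exact Finset.sum_congr rfl fun k _ => by rw [norm_smul, Real.norm_eq_abs]
  refine (pow_le_pow_left₀ (norm_nonneg _) hle 2).trans ?_
  refine (Finset.sum_mul_sq_le_sq_mul_sq _ _ _).trans (le_of_eq ?_)
  have hn : ‖v‖ ^ 2 = v 0 ^ 2 + v 1 ^ 2 := by
    rw [EuclideanSpace.norm_sq_eq]
    simp
  rw [Fintype.sum_prod_type, Fintype.sum_prod_type]
  congr 1
  rw [show ‖v‖ ^ 4 = (‖v‖ ^ 2) ^ 2 by ring, hn]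
  simp only [Fin.sum_univ_two, sq_abs]
  ring

/-- The sum of the squared moduli of the second partial derivatives. -/
noncomputable def hessianSq (f : Plane → ℂ) (x : Plane) : ℝ≥0∞ :=
  ∑ i : Fin 2, ∑ j : Fin 2, ‖secondPartial i j f x‖ₑ ^ 2

lemma enorm_iteratedFDeriv_two_sq_le (f : Plane → ℂ) (x v : Plane) :
    ‖iteratedFDeriv ℝ 2 f x ![v, v]‖ₑ ^ 2 ≤ ‖v‖ₑ ^ 4 * hessianSq f x := by
  have h := ENNReal.ofReal_le_ofReal (norm_bilin_sq_le (iteratedFDeriv ℝ 2 f x) v)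
  rw [ENNReal.ofReal_mul (by positivity), ENNReal.ofReal_pow (norm_nonneg _),
    ENNReal.ofReal_pow (norm_nonneg _), ENNReal.ofReal_sum_of_nonneg (by intros; positivity),
    ofReal_norm, ofReal_norm] at h
  refine h.trans (le_of_eq ?_)
  congr 1
  refine Finset.sum_congr rfl fun i _ => ?_
  rw [ENNReal.ofReal_sum_of_nonneg (by intros; positivity)]
  refine Finset.sum_congr rfl fun j _ => ?_
  rw [ENNReal.ofReal_pow (norm_nonneg _), ofReal_norm]
  rfl

/-- Jensen's inequality for the square on the unit interval. -/
lemma enorm_intervalIntegral_sq_le {g : ℝ → ℂ} (hg : ContinuousOn g (Icc 0 1)) :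
    ‖∫ t in (0 : ℝ)..1, g t‖ₑ ^ 2 ≤ ∫⁻ t in Ioc (0 : ℝ) 1, ‖g t‖ₑ ^ 2 := by
  have : IsProbabilityMeasure (volume.restrict (Ioc (0 : ℝ) 1)) := ⟨by simp⟩
  have hm : AEStronglyMeasurable g (volume.restrict (Ioc (0 : ℝ) 1)) :=
    (hg.mono Ioc_subset_Icc_self).aestronglyMeasurable measurableSet_Ioc
  rw [intervalIntegral.integral_of_le zero_le_one]
  have h12 := eLpNorm_le_eLpNorm_of_exponent_le (p := 1) (q := 2) (by norm_num) hm
  rw [eLpNorm_one_eq_lintegral_enorm] at h12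
  have h2 := eLpNorm_nnreal_pow_eq_lintegral (f := g) (μ := volume.restrict (Ioc (0 : ℝ) 1))
    (p := 2) (by norm_num)
  have h2' : eLpNorm g 2 (volume.restrict (Ioc (0 : ℝ) 1)) ^ 2 =
      ∫⁻ t in Ioc (0 : ℝ) 1, ‖g t‖ₑ ^ 2 := by
    simpa using h2
  rw [← h2']
  exact pow_le_pow_left' ((enorm_integral_le_lintegral_enorm g).trans h12) 2

/-- Integrals over the plane under homotheties of ratio `1 - t`. -/
lemma lintegral_homothety_le {G : Plane → ℝ≥0∞} (hG : Measurable G) (p : Plane) (t : ℝ) :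
    ∫⁻ x, ENNReal.ofReal ((1 - t) ^ 2) * G (x + t • (p - x)) ≤ ∫⁻ x, G x := by
  rcases eq_or_ne (1 - t) 0 with h0 | h0
  · simp [h0]
  have hx : ∀ x : Plane, x + t • (p - x) = (1 - t) • x + t • p := fun x => by module
  simp only [hx]
  rw [lintegral_const_mul _ (by fun_prop)]
  -- The dilation contributes `((1 - t)²)⁻¹` in dimension two, cancelling the weight; the
  -- translation contributes nothing.
  have hmap := lintegral_map (μ := (volume : Measure Plane)) (f := fun y => G (y + t • p))
    (g := fun x : Plane => (1 - t) • x) (by fun_prop) (by fun_prop)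
  rw [Measure.map_addHaar_smul volume h0, lintegral_smul_measure, finrank_euclideanSpace,
    Fintype.card_fin, lintegral_add_right_eq_self] at hmap
  rw [← hmap, smul_eq_mul, ← mul_assoc, ← ENNReal.ofReal_mul (by positivity),
    abs_of_nonneg (by positivity), mul_inv_cancel₀ (by positivity)]
  simp

/-- The `L²` bound of the second order Taylor remainder towards a fixed point `p` of a convex
set. -/
lemma setLIntegral_taylor_remainder_le {f : Plane → ℂ} {U S : Set Plane} (hU : IsOpen U)
    (hf : ContDiffOn ℝ 2 f U) (hSU : S ⊆ U) (hS : Convex ℝ S) (hSm : MeasurableSet S)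
    {p : Plane} (hp : p ∈ S) {h : ℝ} (hh : ∀ x ∈ S, ‖p - x‖ ≤ h) :
    ∫⁻ x in S, ‖∫ t in (0 : ℝ)..1,
        (1 - t) • iteratedFDeriv ℝ 2 f (x + t • (p - x)) ![p - x, p - x]‖ₑ ^ 2 ≤
      ENNReal.ofReal h ^ 4 * ∫⁻ x in S, hessianSq f x := by
  -- Extension by zero allows the change of variables on the whole plane, without following the
  -- image of `S`.
  set G : Plane → ℝ≥0∞ := S.indicator (hessianSq f) with hGdef
  have hseg : ∀ x ∈ S, ∀ t ∈ Icc (0 : ℝ) 1, x + t • (p - x) ∈ S := fun x hx t ht =>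
    hS.add_smul_sub_mem hx hp ht
  have hGm : Measurable G := by
    classical
    have hc : ContinuousOn (hessianSq f) S := by
      refine continuousOn_finsetSum _ fun i _ => continuousOn_finsetSum _ fun j _ => ?_
      exact (ENNReal.continuous_pow 2).comp_continuousOn
        ((continuousOn_iteratedFDeriv_two_apply hU hf _).mono hSU).enorm
    rw [hGdef, ← piecewise_eq_indicator]
    exact hc.measurable_piecewise continuousOn_const hSm
  have hpt : ∀ x ∈ S, ‖∫ t in (0 : ℝ)..1,
        (1 - t) • iteratedFDeriv ℝ 2 f (x + t • (p - x)) ![p - x, p - x]‖ₑ ^ 2 ≤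
      ENNReal.ofReal h ^ 4 *
        ∫⁻ t in Ioc (0 : ℝ) 1, ENNReal.ofReal ((1 - t) ^ 2) * G (x + t • (p - x)) := by
    intro x hx
    have hcont : ContinuousOn (fun t : ℝ =>
        (1 - t) • iteratedFDeriv ℝ 2 f (x + t • (p - x)) ![p - x, p - x]) (Icc 0 1) := by
      refine ContinuousOn.smul (f := fun t : ℝ => 1 - t) (by fun_prop) ?_
      exact (continuousOn_iteratedFDeriv_two_apply hU hf ![p - x, p - x]).comp (by fun_prop)
        fun t ht => hSU (hseg x hx t ht)
    refine (enorm_intervalIntegral_sq_le hcont).trans ?_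
    rw [← lintegral_const_mul _ (by fun_prop)]
    refine setLIntegral_mono (by fun_prop) fun t ht => ?_
    have hmem := hseg x hx t ⟨ht.1.le, ht.2⟩
    have hGx : G (x + t • (p - x)) = hessianSq f (x + t • (p - x)) :=
      indicator_of_mem hmem _
    have hv : ‖p - x‖ₑ ≤ ENNReal.ofReal h := by
      rw [← ofReal_norm]
      exact ENNReal.ofReal_le_ofReal (hh x hx)
    have h1 : ‖(1 - t : ℝ)‖ₑ ^ 2 = ENNReal.ofReal ((1 - t) ^ 2) := by
      rw [← ofReal_norm, ← ENNReal.ofReal_pow (norm_nonneg _), Real.norm_eq_abs, sq_abs]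
    rw [enorm_smul, mul_pow, h1, hGx, mul_left_comm]
    gcongr
    exact (enorm_iteratedFDeriv_two_sq_le f _ _).trans (by gcongr)
  calc _ ≤ ∫⁻ x in S, ENNReal.ofReal h ^ 4 *
        ∫⁻ t in Ioc (0 : ℝ) 1, ENNReal.ofReal ((1 - t) ^ 2) * G (x + t • (p - x)) :=
        setLIntegral_mono' hSm hpt
    _ = ENNReal.ofReal h ^ 4 * ∫⁻ x in S,
        ∫⁻ t in Ioc (0 : ℝ) 1, ENNReal.ofReal ((1 - t) ^ 2) * G (x + t • (p - x)) :=
        lintegral_const_mul' _ _ (by simp)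
    _ ≤ ENNReal.ofReal h ^ 4 * ∫⁻ x in S, hessianSq f x := by
        gcongr _ * ?_
        -- After Tonelli, the homothety bound applies for each fixed `t`, and the `t`-interval has
        -- length 1.
        rw [lintegral_lintegral_swap (by fun_prop), ← lintegral_indicator hSm]
        calc _ ≤ ∫⁻ _ in Ioc (0 : ℝ) 1, ∫⁻ x, G x :=
              lintegral_mono fun t =>
                (setLIntegral_le_lintegral _ _).trans (lintegral_homothety_le hGm p t)
          _ = _ := by simp [hGdef]

/-- The `L²` error of affine interpolation on a triangle, with no condition on its shape. -/
lemma setLIntegral_interpolation_error_le {f : Plane → ℂ} {U : Set Plane} {K : Finset Plane}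
    (hU : IsOpen U) (hf : ContDiffOn ℝ 2 f U) (hKU : closedTriangle K ⊆ U) (hcard : K.card = 3)
    {hat : Plane → Plane → ℝ} (h0 : ∀ x ∈ closedTriangle K, ∀ p ∈ K, 0 ≤ hat p x)
    (h1 : ∀ x ∈ closedTriangle K, ∑ p ∈ K, hat p x = 1)
    (hx : ∀ x ∈ closedTriangle K, ∑ p ∈ K, hat p x • p = x)
    {h : ℝ} (hh : ∀ x ∈ closedTriangle K, ∀ p ∈ K, ‖p - x‖ ≤ h) :
    ∫⁻ x in closedTriangle K, ‖f x - ∑ p ∈ K, (hat p x : ℂ) * f p‖ₑ ^ 2 ≤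
      9 * (ENNReal.ofReal h ^ 4 * ∫⁻ x in closedTriangle K, hessianSq f x) := by
  set S := closedTriangle K
  have hSm : MeasurableSet S := (isClosed_closedTriangle K).measurableSet
  have hSc : Convex ℝ S := convex_convexHull ℝ _
  have hKS : ∀ p ∈ K, p ∈ S := fun p hp => subset_convexHull ℝ _ hp
  set r : Plane → Plane → ℂ := fun p x => ∫ t in (0 : ℝ)..1,
        (1 - t) • iteratedFDeriv ℝ 2 f (x + t • (p - x)) ![p - x, p - x] with hr
  have hT : ∀ p ∈ K, ∀ x ∈ S, f p = f x + fderiv ℝ f x (p - x) + r p x := fun p hp x hxS =>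
    taylor_segment hU hf fun t ht => hKU (hSc.add_smul_sub_mem hxS (hKS p hp) ht)
  have hrc : ∀ p ∈ K, ContinuousOn (r p) S := by
    intro p hp
    have hd : ContinuousOn (fderiv ℝ f) S :=
      (hf.continuousOn_fderiv_of_isOpen hU (by norm_num)).mono hKU
    -- Taylor's formula expresses the remainder through continuous functions, which settles its
    -- measurability.
    refine ContinuousOn.congr (f := fun x => f p - (f x + fderiv ℝ f x (p - x))) ?_
      fun x hxS => (sub_eq_of_eq_add' (hT p hp x hxS)).symm
    exact continuousOn_const.sub ((hf.continuousOn.mono hKU).add (hd.clm_apply (by fun_prop)))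
  have hpt : ∀ x ∈ S, ‖f x - ∑ p ∈ K, (hat p x : ℂ) * f p‖ₑ ^ 2 ≤
      ∑ p ∈ K, 3 * ‖r p x‖ₑ ^ 2 := by
    intro x hxS
    -- Barycentric coordinates satisfy `∑ hat p x • (p - x) = 0`, so the gradient terms drop out.
    have hlin : ∑ p ∈ K, (hat p x : ℂ) * fderiv ℝ f x (p - x) = 0 := by
      have : ∑ p ∈ K, hat p x • (p - x) = 0 := by
        simp only [smul_sub, Finset.sum_sub_distrib, ← Finset.sum_smul, h1 x hxS, hx x hxS,
          one_smul, sub_self]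
      simpa using congrArg (fderiv ℝ f x) this
    have hone : ∑ p ∈ K, (hat p x : ℂ) = 1 := by exact_mod_cast h1 x hxS
    have herr : f x - ∑ p ∈ K, (hat p x : ℂ) * f p = -∑ p ∈ K, (hat p x : ℂ) * r p x := by
      rw [Finset.sum_congr rfl fun p hp => by rw [hT p hp x hxS]]
      simp only [mul_add, Finset.sum_add_distrib, hlin, ← Finset.sum_mul, hone]
      ring
    have hle1 : ∀ p ∈ K, hat p x ≤ 1 := fun p hp =>
      (Finset.single_le_sum (fun q hq => h0 x hxS q hq) hp).trans_eq (h1 x hxS)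
    have hle : ‖f x - ∑ p ∈ K, (hat p x : ℂ) * f p‖ₑ ≤ ∑ p ∈ K, ‖r p x‖ₑ := by
      rw [herr, enorm_neg]
      refine (enorm_sum_le _ _).trans (Finset.sum_le_sum fun p hp => ?_)
      rw [enorm_mul]
      refine mul_le_of_le_one_left' ?_
      rw [← ofReal_norm, Complex.norm_real, Real.norm_of_nonneg (h0 x hxS p hp)]
      exact ENNReal.ofReal_le_one.2 (hle1 p hp)
    refine (pow_le_pow_left' hle 2).trans ?_
    -- `(a + b + c)² ≤ 3(a² + b² + c²)`; summing over the three vertices then yields the factor 9.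
    have := ENNReal.rpow_sum_le_const_mul_sum_rpow K (fun p => ‖r p x‖ₑ) (p := 2) (by norm_num)
    rw [hcard] at this
    norm_num at this
    rwa [← Finset.mul_sum]
  calc _ ≤ ∫⁻ x in S, ∑ p ∈ K, 3 * ‖r p x‖ₑ ^ 2 := setLIntegral_mono' hSm hpt
    _ = ∑ p ∈ K, 3 * ∫⁻ x in S, ‖r p x‖ₑ ^ 2 := by
        rw [lintegral_finsetSum']
        · exact Finset.sum_congr rfl fun p _ => lintegral_const_mul' _ _ (by simp)
        · exact fun p hp => (((hrc p hp).aestronglyMeasurable hSm).enorm.pow_const 2).const_mul 3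
    _ ≤ ∑ p ∈ K, 3 * (ENNReal.ofReal h ^ 4 * ∫⁻ x in S, hessianSq f x) := by
        gcongr with p hp
        exact setLIntegral_taylor_remainder_le hU hf hKU hSc hSm (hKS p hp)
          fun x hxS => hh x hxS p hp
    _ = _ := by
        rw [Finset.sum_const, hcard, nsmul_eq_mul, ← mul_assoc]
        norm_num


/-! ### Norms of continuous functions -/

section Norms

variable {F : Type*} [NormedAddCommGroup F] {f : Plane → F} {Ω : Set Plane}

lemma eLpNorm_ne_top_of_continuousOn (hb : Bornology.IsBounded Ω)
    (hf : ContinuousOn f (closure Ω)) (q : ℝ≥0∞) : eLpNorm f q (volume.restrict Ω) ≠ ⊤ := by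
  obtain ⟨B, hB⟩ := hb.isCompact_closure.exists_bound_of_continuousOn hf
  have hfin : volume.restrict Ω univ ≠ ⊤ := by
    rw [Measure.restrict_apply_univ]
    exact hb.measure_lt_top.ne
  refine ne_top_of_le_ne_top ?_ (eLpNorm_le_of_ae_bound (C := B)
    (ae_restrict_of_ae_restrict_of_subset subset_closure
      (ae_restrict_of_forall_mem isClosed_closure.measurableSet hB)))
  exact ENNReal.mul_ne_top (ENNReal.rpow_ne_top_of_nonneg (by positivity) hfin)
    ENNReal.ofReal_ne_top

/-- A continuous function is bounded by its essential supremum, up to the boundary. -/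
lemma norm_le_toReal_eLpNorm_top (hΩ : IsOpen Ω) (hb : Bornology.IsBounded Ω)
    (hf : ContinuousOn f (closure Ω)) {x : Plane} (hx : x ∈ closure Ω) :
    ‖f x‖ ≤ (eLpNorm f ⊤ (volume.restrict Ω)).toReal := by
  set a := (eLpNorm f ⊤ (volume.restrict Ω)).toReal
  have hcont : ContinuousOn (fun x => ‖f x‖) Ω := (hf.mono subset_closure).norm
  -- The set where `‖f‖` exceeds the essential supremum is open and null, hence empty.
  have hopen : IsOpen (Ω ∩ (fun x => ‖f x‖) ⁻¹' Ioi a) := hcont.isOpen_inter_preimage hΩ isOpen_Ioi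
  have hnull : volume (Ω ∩ (fun x => ‖f x‖) ⁻¹' Ioi a) = 0 := by
    have hae := ae_le_eLpNormEssSup (f := f) (μ := volume.restrict Ω)
    rw [ae_restrict_iff' hΩ.measurableSet] at hae
    refine measure_mono_null ?_ hae
    rintro y ⟨hy, hya⟩ hle
    have h2 := ENNReal.toReal_mono (eLpNorm_ne_top_of_continuousOn hb hf ⊤)
      ((hle hy).trans_eq eLpNorm_exponent_top.symm)
    rw [toReal_enorm] at h2
    exact absurd h2 (not_le.2 hya)
  have hempty := hopen.measure_eq_zero_iff (μ := volume) |>.1 hnull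
  have hle : ∀ y ∈ Ω, ‖f y‖ ≤ a := fun y hy => by
    by_contra h
    exact hempty.subset ⟨hy, not_le.1 h⟩
  exact ContinuousWithinAt.closure_le hx ((hf x hx).norm.mono subset_closure)
    continuousWithinAt_const hle

lemma eLpNorm_two_sq {E : Type*} [NormedAddCommGroup E] (g : Plane → E) (μ : Measure Plane) :
    eLpNorm g 2 μ ^ 2 = ∫⁻ x, ‖g x‖ₑ ^ 2 ∂μ := by
  simpa using eLpNorm_nnreal_pow_eq_lintegral (f := g) (μ := μ) (p := 2) (by norm_num)

end Norms

/-- Writes the squared seminorm as one integral, which can be split over triangles. -/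
lemma seminormH2_sq {Ω : Set Plane} (hΩ : IsOpen Ω) {f : Plane → ℂ} {U : Set Plane}
    (hU : IsOpen U) (hΩU : Ω ⊆ U) (hf : ContDiffOn ℝ 2 f U) :
    seminormH2 Ω f ^ 2 = ∫⁻ x in Ω, hessianSq f x := by
  have hm : ∀ i j, AEMeasurable (fun x => ‖secondPartial i j f x‖ₑ ^ 2) (volume.restrict Ω) :=
    fun i j => ((((continuousOn_iteratedFDeriv_two_apply hU hf _).mono
      hΩU).aestronglyMeasurable hΩ.measurableSet).enorm.pow_const 2)
  rw [seminormH2, ← ENNReal.rpow_natCast, ← ENNReal.rpow_mul,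
    show (1 / 2 : ℝ) * ((2 : ℕ) : ℝ) = 1 by norm_num, ENNReal.rpow_one]
  simp only [hessianSq]
  rw [lintegral_finsetSum' Finset.univ fun i _ =>
    Finset.univ.aemeasurable_fun_sum fun j _ => hm i j]
  refine Finset.sum_congr rfl fun i _ => ?_
  rw [lintegral_finsetSum' Finset.univ fun j _ => hm i j]
  exact Finset.sum_congr rfl fun j _ => eLpNorm_two_sq _ _

/-! ### The phase error -/

lemma norm_exp_I_sub_exp_I_le (s t : ℝ) :
    ‖Complex.exp (Complex.I * (s : ℂ)) - Complex.exp (Complex.I * (t : ℂ))‖ ≤ |s - t| := by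
  have h : Complex.exp (Complex.I * (s : ℂ)) - Complex.exp (Complex.I * (t : ℂ)) =
      Complex.exp (Complex.I * (t : ℂ)) * (Complex.exp (Complex.I * ((s - t : ℝ) : ℂ)) - 1) := by
    rw [mul_sub, mul_one, ← Complex.exp_add]
    push_cast
    ring_nf
  rw [h, norm_mul, Complex.norm_exp_I_mul_ofReal, one_mul]
  exact Real.norm_exp_I_mul_ofReal_sub_one_le

/-- With the eikonal equation, the ray plane wave at `p` is the wave of the linearized phase. -/
lemma mul_inner_rayDirection {φ c : Plane → ℝ} {p : Plane} (hc : 0 < c p)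
    (he : ‖gradient φ p‖ = 1 / c p) (ω : ℝ) (x : Plane) :
    ω / c p * inner ℝ (rayDirection φ p) x = ω * fderiv ℝ φ p x := by
  have hg : inner ℝ (gradient φ p) x = fderiv ℝ φ p x := by
    rw [gradient, InnerProductSpace.toDual_symm_apply]
  rw [rayDirection, real_inner_smul_left, hg, he]
  field_simp

/-! ### Approximation of the geometric optics wave -/

/-- The ray-FEM interpolant of a geometric optics wave. -/
noncomputable def rayInterpolant (V : Finset Plane) (hat : Plane → Plane → ℝ) (A : Plane → ℂ) (φ c : Plane → ℝ)
    (ω : ℝ) (x : Plane) : ℂ :=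
  ∑ p ∈ V, (hat p x : ℂ) * (A p *
    -- This constant phase makes the wave at `p` agree with the geometric optics wave at `x = p`.
    Complex.exp (Complex.I * ((ω * φ p - ω / c p * inner ℝ (rayDirection φ p) p : ℝ) : ℂ)) *
      planeWave (ω / c p) (rayDirection φ p) x)

lemma continuous_planeWave (κ : ℝ) (d : Plane) : Continuous (planeWave κ d) := by
  unfold planeWave
  fun_prop

variable {T : Geometry.SimplicialComplex ℝ Plane} {Ω : Set Plane}

/-- Coefficients and plane waves belong to nodes, not triangles, so continuity rests on the hat
functions; on a triangle only its own vertices contribute. -/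
lemma rayInterpolant_mem_exactRaySpace {V : Finset Plane} {hat : Plane → Plane → ℝ}
    (hV : ∀ K ∈ triangles T, K ⊆ V) (hcont : ∀ p, ContinuousOn (hat p) (closure Ω))
    (hhat : ∀ K ∈ triangles T, ∀ p, ∃ ψ : Plane →ᵃ[ℝ] ℝ,
        (∀ q ∈ K, ψ q = if q = p then 1 else 0) ∧ EqOn (hat p) ψ (closedTriangle K))
    (A : Plane → ℂ) (φ c : Plane → ℝ) (ω : ℝ) :
    rayInterpolant V hat A φ c ω ∈ exactRaySpace Ω T c φ ω := by
  refine ⟨?_, fun K hK => ?_⟩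
  · refine continuousOn_finsetSum _ fun p _ => ?_
    exact (Complex.continuous_ofReal.comp_continuousOn (hcont p)).mul
      (continuousOn_const.mul (continuous_planeWave _ _).continuousOn)
  · choose ψ hψ hψe using hhat K hK
    refine ⟨∑ p ∈ K, (A p * Complex.exp (Complex.I *
        ((ω * φ p - ω / c p * inner ℝ (rayDirection φ p) p : ℝ) : ℂ))) •
          fun x => ((ψ p x : ℝ) : ℂ) * planeWave (ω / c p) (rayDirection φ p) x,
      Submodule.sum_mem _ fun p hp => Submodule.smul_mem _ _ (Submodule.subset_span
        ⟨p, hp, ψ p, ⟨by simpa using hψ p p hp, fun q hq hqp => by simpa [hqp] using hψ p q hq⟩,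
          rayDirection φ p, rfl, rfl⟩), fun x hx => ?_⟩
    rw [rayInterpolant, Finset.sum_apply]
    rw [← Finset.sum_subset (hV K hK) fun p _ hp => by
      rw [(hat_eq_weights (hhat K hK) hx).2.1 p hp]; simp]
    refine Finset.sum_congr rfl fun p _ => ?_
    rw [hψe p hx, Pi.smul_apply, smul_eq_mul]
    ring

/-- The best approximation error for a geometric optics wave with an error term. -/
lemma bestError_le (hΩ : IsOpen Ω) (hreg : interior (closure Ω) = Ω)
    (hb : Bornology.IsBounded Ω) (hT : IsMesh T Ω) {U : Set Plane} (hU : IsOpen U)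
    (hΩU : closure Ω ⊆ U) {A : Plane → ℂ} {φ c : Plane → ℝ} (hA : ContDiffOn ℝ 2 A U)
    (hφ : ContDiffOn ℝ 2 φ U) (heik : ∀ x ∈ closure Ω, 0 < c x ∧ ‖gradient φ x‖ = 1 / c x)
    {ω : ℝ} (hω : 0 ≤ ω) {u : Plane → ℂ} (hu : MemLp u 2 (volume.restrict Ω)) :
    bestError Ω (exactRaySpace Ω T c φ ω) u ≤
      normL2 Ω (u - goWave A φ ω) +
        (3 * (ENNReal.ofReal (meshWidth T ^ 2) * seminormH2 Ω A) +
          volume Ω ^ (1 / 2 : ℝ) * (ENNReal.ofReal (ω * meshWidth T ^ 2) * normLinf Ω A *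
            hessianLinf Ω φ)) := by
  classical
  obtain ⟨hat, hcont, hhat⟩ := hT.exists_hat
  set s : Finset (Finset Plane) := hT.finite_triangles.toFinset
  have hs : ∀ K, K ∈ s ↔ K ∈ triangles T := fun K => by simp [s]
  set V : Finset Plane := s.biUnion id
  have hV : ∀ K ∈ triangles T, K ⊆ V := fun K hK => Finset.subset_biUnion_of_mem id ((hs K).2 hK)
  set h := meshWidth T
  have hh0 : 0 ≤ h := meshWidth_nonneg T
  have hAc : ContinuousOn A (closure Ω) := hA.continuousOn.mono hΩU
  have hφc : ContinuousOn φ (closure Ω) := hφ.continuousOn.mono hΩU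
  have hDφ : ContinuousOn (iteratedFDeriv ℝ 2 φ) (closure Ω) :=
    (continuousOn_iteratedFDeriv_two hU hφ).mono hΩU
  set a := (normLinf Ω A).toReal
  set b := (hessianLinf Ω φ).toReal
  have hAa : ∀ x ∈ closure Ω, ‖A x‖ ≤ a := fun x hx => norm_le_toReal_eLpNorm_top hΩ hb hAc hx
  have hφb : ∀ x ∈ closure Ω, ‖iteratedFDeriv ℝ 2 φ x‖ ≤ b := fun x hx =>
    norm_le_toReal_eLpNorm_top hΩ hb hDφ hx
  set IA : Plane → ℂ := fun x => ∑ p ∈ V, (hat p x : ℂ) * A p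
  set v : Plane → ℂ := rayInterpolant V hat A φ c ω
  have hvmem : v ∈ exactRaySpace Ω T c φ ω :=
    rayInterpolant_mem_exactRaySpace hV hcont hhat A φ c ω
  have hIAK : ∀ K ∈ triangles T, ∀ x ∈ closedTriangle K, IA x = ∑ p ∈ K, (hat p x : ℂ) * A p := by
    intro K hK x hx
    exact (Finset.sum_subset (hV K hK) fun p _ hp => by
      rw [(hat_eq_weights (hhat K hK) hx).2.1 p hp]; simp).symm
  have hKmem : ∀ {K : Finset Plane}, ∀ p ∈ K, p ∈ closedTriangle K := fun p hp =>
    subset_convexHull ℝ _ hp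
  have hdist : ∀ K ∈ triangles T, ∀ x ∈ closedTriangle K, ∀ y ∈ closedTriangle K,
      ‖x - y‖ ≤ h := fun K hK x hx y hy => by
    rw [← dist_eq_norm]
    exact dist_le_meshWidth hT hK hx hy
  set E : Plane → ℂ := fun x => Complex.exp (Complex.I * ((ω * φ x : ℝ) : ℂ)) with hE
  -- amplitude error
  have hamp : normL2 Ω ((A - IA) * E) ≤ 3 * (ENNReal.ofReal (h ^ 2) * seminormH2 Ω A) := by
    rw [← ENNReal.pow_le_pow_left_iff two_ne_zero, normL2, eLpNorm_two_sq]
    calc ∫⁻ x in Ω, ‖((A - IA) * E) x‖ₑ ^ 2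
        = ∫⁻ x in Ω, ‖A x - IA x‖ₑ ^ 2 := by
          refine lintegral_congr fun x => ?_
          have : ‖E x‖ₑ = 1 := by
            rw [← ofReal_norm, Complex.norm_exp_I_mul_ofReal, ENNReal.ofReal_one]
          simp [enorm_mul, this]
      _ ≤ ∑ K ∈ s, ∫⁻ x in closedTriangle K, ‖A x - IA x‖ₑ ^ 2 :=
          setLIntegral_le_sum_closedTriangle hT hs _
      _ ≤ ∑ K ∈ s, 9 * (ENNReal.ofReal h ^ 4 * ∫⁻ x in closedTriangle K, hessianSq A x) := by
          refine Finset.sum_le_sum fun K hK => ?_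
          replace hK := (hs K).1 hK
          have hw := fun x (hx : x ∈ closedTriangle K) => hat_eq_weights (hhat K hK) hx
          rw [setLIntegral_congr_fun (isClosed_closedTriangle K).measurableSet
            fun x hx => by rw [hIAK K hK x hx]]
          exact setLIntegral_interpolation_error_le hU hA
            ((hT.closedTriangle_subset hK).trans hΩU) hK.2 (fun x hx => (hw x hx).1)
            (fun x hx => (hw x hx).2.2.1) (fun x hx => (hw x hx).2.2.2)
            fun x hx p hp => hdist K hK p (hKmem p hp) x hx
      _ ≤ 9 * (ENNReal.ofReal h ^ 4 * ∫⁻ x in Ω, hessianSq A x) := by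
          rw [← Finset.mul_sum, ← Finset.mul_sum]
          gcongr
          exact sum_setLIntegral_closedTriangle_le hT hreg hs _
      _ = _ := by
          rw [mul_pow, mul_pow, seminormH2_sq hΩ hU (subset_closure.trans hΩU) hA,
            ENNReal.ofReal_pow hh0]
          ring
  -- phase error
  have hphase_pt : ∀ x ∈ closure Ω,
      ‖(goWave A φ ω - v - (A - IA) * E) x‖ ≤ a * (ω * (b * h ^ 2)) := by
    intro x hx
    obtain ⟨K, hK, hxK⟩ := hT.exists_mem hx
    obtain ⟨h0, hz, h1, -⟩ := hat_eq_weights (hhat K hK) hxK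
    -- The eikonal equation turns each nodal wave into that of the phase linearized at `p`.
    have hvx : v x = ∑ p ∈ K, (hat p x : ℂ) * (A p *
        Complex.exp (Complex.I * ((ω * (φ p + fderiv ℝ φ p (x - p)) : ℝ) : ℂ))) := by
      refine (Finset.sum_subset (hV K hK) fun p _ hp => by rw [hz p hp]; simp).symm.trans ?_
      refine Finset.sum_congr rfl fun p hp => ?_
      have hpΩ := hT.closedTriangle_subset hK (hKmem p hp)
      rw [planeWave, mul_inner_rayDirection (heik p hpΩ).1 (heik p hpΩ).2,
        mul_inner_rayDirection (heik p hpΩ).1 (heik p hpΩ).2, mul_assoc, ← Complex.exp_add,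
        map_sub]
      push_cast
      ring_nf
    have hdiff : (goWave A φ ω - v - (A - IA) * E) x = ∑ p ∈ K, (hat p x : ℂ) * (A p *
        (E x - Complex.exp (Complex.I * ((ω * (φ p + fderiv ℝ φ p (x - p)) : ℝ) : ℂ)))) := by
      simp only [mul_sub, Finset.sum_sub_distrib]
      rw [← hvx]
      simp only [← mul_assoc, ← Finset.sum_mul]
      rw [← hIAK K hK x hxK]
      simp only [Pi.sub_apply, Pi.mul_apply, goWave, hE]
      ring
    have ha0 : 0 ≤ a := ENNReal.toReal_nonneg
    rw [hdiff]
    calc _ ≤ ∑ p ∈ K, hat p x * (a * (ω * (b * h ^ 2))) := by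
          refine (norm_sum_le _ _).trans (Finset.sum_le_sum fun p hp => ?_)
          have hpK := hKmem p hp
          have hpΩ := hT.closedTriangle_subset hK hpK
          have hmem : ∀ t ∈ Icc (0 : ℝ) 1, p + t • (x - p) ∈ closure Ω := fun t ht =>
            hT.closedTriangle_subset hK
              ((convex_convexHull ℝ (K : Set Plane)).add_smul_sub_mem hpK hxK ht)
          rw [norm_mul, norm_mul, Complex.norm_real, Real.norm_of_nonneg (h0 p hp)]
          refine mul_le_mul_of_nonneg_left ?_ (h0 p hp)
          refine mul_le_mul (hAa p hpΩ) ?_ (norm_nonneg _) ha0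
          refine (norm_exp_I_sub_exp_I_le _ _).trans ?_
          rw [← mul_sub, abs_mul, abs_of_nonneg hω]
          refine mul_le_mul_of_nonneg_left ?_ hω
          exact norm_sub_taylor_le hU hφ (fun t ht => hΩU (hmem t ht))
            (fun t ht => hφb _ (hmem t ht)) (hdist K hK x hxK p hpK)
      _ = _ := by rw [← Finset.sum_mul, h1, one_mul]
  have hphase : normL2 Ω (goWave A φ ω - v - (A - IA) * E) ≤
      volume Ω ^ (1 / 2 : ℝ) * (ENNReal.ofReal (ω * h ^ 2) * normLinf Ω A * hessianLinf Ω φ) := by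
    refine (eLpNorm_le_of_ae_bound (C := a * (ω * (b * h ^ 2)))
      (ae_restrict_of_forall_mem hΩ.measurableSet
        fun x hx => hphase_pt x (subset_closure hx))).trans (le_of_eq ?_)
    rw [Measure.restrict_apply_univ]
    have hna : normLinf Ω A = ENNReal.ofReal a :=
      (ENNReal.ofReal_toReal (eLpNorm_ne_top_of_continuousOn hb hAc ⊤)).symm
    have hnb : hessianLinf Ω φ = ENNReal.ofReal b :=
      (ENNReal.ofReal_toReal (eLpNorm_ne_top_of_continuousOn hb hDφ ⊤)).symm
    rw [hna, hnb, ← ENNReal.ofReal_mul (by positivity), ← ENNReal.ofReal_mul (by positivity)]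
    congr 2
    · norm_num
    · ring
  -- measurability
  have hgoc : ContinuousOn (goWave A φ ω) (closure Ω) := by
    unfold goWave
    fun_prop
  have hEc : ContinuousOn E (closure Ω) := by fun_prop
  have hIAc : ContinuousOn IA (closure Ω) :=
    continuousOn_finsetSum _ fun p _ =>
      (Complex.continuous_ofReal.comp_continuousOn (hcont p)).mul continuousOn_const
  have hmeas : ∀ {f : Plane → ℂ}, ContinuousOn f (closure Ω) →
      AEStronglyMeasurable f (volume.restrict Ω) := fun hf =>
    (hf.mono subset_closure).aestronglyMeasurable hΩ.measurableSet
  have hm1 : AEStronglyMeasurable (u - goWave A φ ω) (volume.restrict Ω) :=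
    hu.1.sub (hmeas hgoc)
  have hm2 : AEStronglyMeasurable ((A - IA) * E) (volume.restrict Ω) :=
    hmeas ((hAc.sub hIAc).mul hEc)
  have hm3 : AEStronglyMeasurable (goWave A φ ω - v - (A - IA) * E) (volume.restrict Ω) :=
    hmeas ((hgoc.sub hvmem.1).sub ((hAc.sub hIAc).mul hEc))
  -- Ansatz error, amplitude error and phase error.
  have hsplit : u - v = (u - goWave A φ ω) + ((A - IA) * E +
      (goWave A φ ω - v - (A - IA) * E)) := by abel
  refine (iInf₂_le v hvmem).trans ?_
  rw [hsplit]
  refine (eLpNorm_add_le hm1 (hm2.add hm3) (by norm_num)).trans ?_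
  exact add_le_add le_rfl ((eLpNorm_add_le hm2 hm3 (by norm_num)).trans (add_le_add hamp hphase))

end RayFEM

/-! ### The three estimates of the theorem -/

open RayFEM in
theorem mainTheorem1 (Ω : Set Plane) (hbounded : Bornology.IsBounded Ω)
    (hregular : interior (closure Ω) = Ω) :
    ∃ C : ℝ≥0, ∀ (A : Plane → ℂ) (φ c : Plane → ℝ) (u : ℝ → Plane → ℂ),
      -- the amplitude and the phase are smooth (twice continuously differentiable) up to the
      -- boundary
      (∃ U : Set Plane, IsOpen U ∧ closure Ω ⊆ U ∧ ContDiffOn ℝ 2 A U ∧ ContDiffOn ℝ 2 φ U) →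
      -- positive wave speed and eikonal equation
      (∀ x ∈ closure Ω, 0 < c x ∧ ‖gradient φ x‖ = 1 / c x) →
      GeometricOpticsAnsatz Ω A φ u →
      (∃ R : ℝ, ∀ᶠ ω : ℝ in atTop, ∀ T : Geometry.SimplicialComplex ℝ Plane, IsMesh T Ω →
        bestError Ω (exactRaySpace Ω T c φ ω) (u ω) ≤
          C * (ENNReal.ofReal (meshWidth T ^ 2) * seminormH2 Ω A +
            ENNReal.ofReal (ω * meshWidth T ^ 2) * normLinf Ω A * hessianLinf Ω φ) +
          ENNReal.ofReal (R / ω)) ∧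
      (∃ M : ℝ, ∀ᶠ ω : ℝ in atTop, ∀ T : Geometry.SimplicialComplex ℝ Plane, IsMesh T Ω →
        bestError Ω (exactRaySpace Ω T c φ ω) (u ω) ≤
          ENNReal.ofReal (M * (meshWidth T ^ 2 + ω * meshWidth T ^ 2 + 1 / ω))) ∧
      (∀ κ : ℝ, 0 < κ → ∃ M : ℝ, ∀ᶠ ω : ℝ in atTop,
        ∀ T : Geometry.SimplicialComplex ℝ Plane, IsMesh T Ω → meshWidth T ≤ κ / ω →
          bestError Ω (exactRaySpace Ω T c φ ω) (u ω) ≤ ENNReal.ofReal (M / ω)) := by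
  have hΩ : IsOpen Ω := hregular ▸ isOpen_interior
  have hvol : volume Ω ^ (1 / 2 : ℝ) ≠ ⊤ :=
    ENNReal.rpow_ne_top_of_nonneg (by norm_num) hbounded.measure_lt_top.ne
  -- The 3 is the square root of the interpolation constant 9; `|Ω|^{1/2}` comes from passing from a
  -- uniform bound to `L²` for the phase error.
  refine ⟨3 + (volume Ω ^ (1 / 2 : ℝ)).toNNReal, ?_⟩
  intro A φ c u ⟨U, hU, hΩU, hA, hφ⟩ heik ⟨hu, R, hR⟩
  set C : ℝ≥0 := 3 + (volume Ω ^ (1 / 2 : ℝ)).toNNReal with hC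
  have hC' : (C : ℝ≥0∞) = 3 + volume Ω ^ (1 / 2 : ℝ) := by
    rw [hC, ENNReal.coe_add, ENNReal.coe_toNNReal hvol]
    norm_num
  have hmain : ∀ᶠ ω : ℝ in atTop, ∀ T : Geometry.SimplicialComplex ℝ Plane, IsMesh T Ω →
      bestError Ω (exactRaySpace Ω T c φ ω) (u ω) ≤
        C * (ENNReal.ofReal (meshWidth T ^ 2) * seminormH2 Ω A +
          ENNReal.ofReal (ω * meshWidth T ^ 2) * normLinf Ω A * hessianLinf Ω φ) +
        ENNReal.ofReal (R / ω) := by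
    filter_upwards [hu, hR, eventually_ge_atTop 0] with ω hω1 hω2 hω0 T hT
    refine (bestError_le hΩ hregular hbounded hT hU hΩU hA hφ heik hω0 hω1).trans ?_
    rw [add_comm]
    refine add_le_add ?_ hω2
    rw [mul_add, hC']
    gcongr
    · exact le_self_add
    · exact le_add_self
  -- The sign of `M` is recorded because the third estimate multiplies an inequality by `M`.
  have hsecond : ∃ M : ℝ, 0 ≤ M ∧ ∀ᶠ ω : ℝ in atTop, ∀ T : Geometry.SimplicialComplex ℝ Plane,
      IsMesh T Ω → bestError Ω (exactRaySpace Ω T c φ ω) (u ω) ≤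
        ENNReal.ofReal (M * (meshWidth T ^ 2 + ω * meshWidth T ^ 2 + 1 / ω)) := by
    have hfinA : normLinf Ω A ≠ ⊤ :=
      eLpNorm_ne_top_of_continuousOn hbounded (hA.continuousOn.mono hΩU) ⊤
    have hfinφ : hessianLinf Ω φ ≠ ⊤ :=
      eLpNorm_ne_top_of_continuousOn hbounded
        ((continuousOn_iteratedFDeriv_two hU hφ).mono hΩU) ⊤
    have hfinH : seminormH2 Ω A ≠ ⊤ := by
      refine ENNReal.rpow_ne_top_of_nonneg (by norm_num) ?_
      refine ENNReal.sum_ne_top.2 fun i _ => ENNReal.sum_ne_top.2 fun j _ => ?_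
      exact ENNReal.pow_ne_top (eLpNorm_ne_top_of_continuousOn hbounded
        ((continuousOn_iteratedFDeriv_two_apply hU hA _).mono hΩU) 2)
    set α := (seminormH2 Ω A).toReal with hα
    set β := (normLinf Ω A).toReal * (hessianLinf Ω φ).toReal with hβ
    have hα0 : 0 ≤ α := ENNReal.toReal_nonneg
    have hβ0 : 0 ≤ β := mul_nonneg ENNReal.toReal_nonneg ENNReal.toReal_nonneg
    refine ⟨C * α + C * β + |R|, by positivity, ?_⟩
    filter_upwards [hmain, eventually_gt_atTop 0] with ω hω hω0 T hT
    have hc0 : 0 ≤ (C : ℝ) := C.2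
    refine (hω T hT).trans ?_
    rw [mul_assoc (ENNReal.ofReal _) (normLinf Ω A), ← ENNReal.ofReal_toReal hfinH,
      ← ENNReal.ofReal_toReal (ENNReal.mul_ne_top hfinA hfinφ), ENNReal.toReal_mul,
      ← hα, ← hβ, ← ENNReal.ofReal_coe_nnreal, ← ENNReal.ofReal_mul (by positivity),
      ← ENNReal.ofReal_mul (by positivity), ← ENNReal.ofReal_add (by positivity) (by positivity),
      ← ENNReal.ofReal_mul (by positivity)]
    refine (add_le_add le_rfl (ENNReal.ofReal_le_ofReal
      (div_le_div_of_nonneg_right (le_abs_self R) hω0.le))).trans ?_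
    rw [← ENNReal.ofReal_add (by positivity) (by positivity)]
    refine ENNReal.ofReal_le_ofReal ?_
    set X := meshWidth T ^ 2
    have hX : 0 ≤ X := by positivity
    have hY : 0 ≤ ω * X := by positivity
    have hZ : 0 ≤ 1 / ω := by positivity
    rw [div_eq_mul_one_div |R| ω]
    -- The cross terms by which the product `M * (...)` exceeds the three wanted terms.
    have e1 := mul_nonneg (mul_nonneg hc0 hα0) (add_nonneg hY hZ)
    have e2 := mul_nonneg (mul_nonneg hc0 hβ0) (add_nonneg hX hZ)
    have e3 := mul_nonneg (abs_nonneg R) (add_nonneg hX hY)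
    linarith
  refine ⟨⟨R, hmain⟩, hsecond.imp fun M hM => hM.2, fun κ hκ => ?_⟩
  obtain ⟨M, hM0, hM⟩ := hsecond
  -- For `ω ≥ 1` and `h ≤ κ / ω`, both `h²` and `ω h²` are at most `κ² / ω`.
  refine ⟨M * (2 * κ ^ 2 + 1), ?_⟩
  filter_upwards [hM, eventually_ge_atTop 1] with ω hω hω1 T hT hh
  refine (hω T hT).trans (ENNReal.ofReal_le_ofReal ?_)
  have hω0 : 0 < ω := by linarith
  have hh2 : meshWidth T ^ 2 ≤ (κ / ω) ^ 2 := pow_le_pow_left₀ (meshWidth_nonneg T) hh 2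
  have h2 : ω * meshWidth T ^ 2 ≤ κ ^ 2 / ω := by
    refine (mul_le_mul_of_nonneg_left hh2 hω0.le).trans (le_of_eq ?_)
    field_simp
  have h1 : meshWidth T ^ 2 ≤ ω * meshWidth T ^ 2 := le_mul_of_one_le_left (sq_nonneg _) hω1
  rw [mul_div_assoc]
  refine mul_le_mul_of_nonneg_left ?_ hM0
  have : (2 * κ ^ 2 + 1) / ω = κ ^ 2 / ω + κ ^ 2 / ω + 1 / ω := by ring
  rw [this]
  linarith
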